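/- All spaces are complex. For an interpolation couple $[A_0,A_1]$ (two Banach spaces continuously embedded in a common space $X$) and $0<\theta<1$, $[A_0,A_1]_\theta$ denotes Calderón's complex interpolation space: the vectors $x=f(\theta)$, where $f$ is bounded and continuous on the strip $0\le \operatorname{Re} z\le 1$, holomorphic in its interior, and $t\mapsto f(j+it)$ is a continuous $A_j$-valued function vanishing at infinity ($j=0,1$), normed by $\|x\|_\theta=\inf\{\max_{j}\sup_t\|f(j+it)\|_{A_j} : f(\theta)=x\}$. A finite-dimensional interpolation couple is one whose two members have the same finite dimension. For Banach spaces $A,B$, $\Gamma_2(A,B)$ is the space of all operators $T:A\to B$ that factor as $T=RS$ through a Hilbert space, with norm $\gamma_2(T)=\inf\|R\|\,\|S\|$. For a finite-dimensional couple $[E_0,E_1]$ put $$d_\theta[E_0,E_1]:=\big\|\mathcal L(\ell_2,[E_0,E_1]_\theta)\hookrightarrow[\mathcal L(\ell_2,E_0),\mathcal L(\ell_2,E_1)]_\theta\big\|.$$ **Lemma 9.** Let $[E_0,E_1]$ and $[F_0,F_1]$ be finite-dimensional interpolation couples and $0<\theta<1$. Then $d_\theta[E_0,E_1]$ and $d_\theta[F_0,F_1]$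 are finite, and $$\big\|\Gamma_2\big(([E_0,E_1]_\theta)',[F_0,F_1]_\theta\big)\hookrightarrow[\Gamma_2(E_0',F_0),\Gamma_2(E_1',F_1)]_\theta\big\|\le d_\theta[E_0,E_1]\cdot d_\theta[F_0,F_1].$$ Here, if $E_0,E_1$ are embedded in $E$ and $F_0,F_1$ in $F$, all spaces $\mathcal L(\ell_2,\cdot)$ in $d_\theta[E_0,E_1]$ (respectively $d_\theta[F_0,F_1]$) are regarded as subspaces of $\mathcal L(\ell_2,E)$ (respectively $\mathcal L(\ell_2,F)$), and the spaces $\Gamma_2(G',K)$, with $G\subset E$ and $K\subset F$, as spaces of operators $E'\to G'\to K\to F$ (restriction, operator, inclusion). -/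

import Mathlib

open Complex Set
open scoped ENNReal ZeroAtInfty

noncomputable section

universe u v w

/-! ### Norms given by an infimum -/

/-- If `P x C` says that `C` is an admissible bound for `x`, then, under the natural compatibility
conditions, the infimum of the admissible bounds is a norm. -/
theorem infNorm_core {V : Type*} {X : Type*} [AddCommGroup V] [Module ℂ V] [Norm V]
    [NormedAddCommGroup X] [NormedSpace ℂ X] (P : V → ℝ → Prop)
    (hN : ∀ x, ‖x‖ = sInf {C : ℝ | P x C})
    (hne : ∀ x, ∃ C, P x C) (hpos : ∀ x C, P x C → 0 ≤ C)
    (hadd : ∀ x y C D, P x C → P y D → ∀ ε > 0, ∃ B ≤ C + D + ε, P (x + y) B)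
    (hsmul : ∀ (c : ℂ) x C, P x C → ∃ B ≤ ‖c‖ * C, P (c • x) B)
    (ι : V →ₗ[ℂ] X) (hι : Function.Injective ι) (K : ℝ) (hK : ∀ x C, P x C → ‖ι x‖ ≤ K * C) :
    NormedSpace.Core ℂ V := by
  have hbdd : ∀ x, BddBelow {C : ℝ | P x C} := fun x => ⟨0, fun C hC => hpos x C hC⟩
  have hle : ∀ x C, P x C → ‖x‖ ≤ C := fun x C h => by
    rw [hN]; exact csInf_le (hbdd x) h
  have hnn : ∀ x : V, 0 ≤ ‖x‖ := fun x => by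
    rw [hN]; exact Real.sInf_nonneg fun C hC => hpos x C hC
  have happrox : ∀ (x : V) (ε : ℝ), 0 < ε → ∃ C, P x C ∧ C < ‖x‖ + ε := fun x ε hε => by
    have h := exists_lt_of_csInf_lt (s := {C : ℝ | P x C}) (hne x)
      (show sInf {C : ℝ | P x C} < ‖x‖ + ε by rw [← hN]; linarith)
    obtain ⟨C, hC, hlt⟩ := h
    exact ⟨C, hC, hlt⟩
  have hsm : ∀ (c : ℂ) (x : V), ‖c • x‖ ≤ ‖c‖ * ‖x‖ := fun c x => by
    refine le_of_forall_pos_le_add fun ε hε => ?_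
    obtain ⟨C, hC, hlt⟩ := happrox x (ε / (‖c‖ + 1)) (by positivity)
    obtain ⟨B, hB, hPB⟩ := hsmul c x C hC
    have h1 := hle _ _ hPB
    have h2 : ‖c‖ * (ε / (‖c‖ + 1)) ≤ ε := by
      rw [mul_div_assoc', div_le_iff₀ (by positivity)]
      nlinarith [norm_nonneg c]
    nlinarith [mul_le_mul_of_nonneg_left hlt.le (norm_nonneg c)]
  have hKx : ∀ x : V, ‖ι x‖ ≤ max K 0 * ‖x‖ := fun x => by
    refine le_of_forall_pos_le_add fun ε hε => ?_
    obtain ⟨C, hC, hlt⟩ := happrox x (ε / (max K 0 + 1)) (by positivity)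
    have h1 := hK x C hC
    have h0 := hpos x C hC
    have hM : 0 ≤ max K 0 := le_max_right _ _
    have h2 : max K 0 * (ε / (max K 0 + 1)) ≤ ε := by
      rw [mul_div_assoc', div_le_iff₀ (by positivity)]
      nlinarith
    have h3 : K * C ≤ max K 0 * C := mul_le_mul_of_nonneg_right (le_max_left _ _) h0
    nlinarith [mul_le_mul_of_nonneg_left hlt.le hM]
  refine { norm_nonneg := hnn, norm_smul := ?_, norm_triangle := ?_, norm_eq_zero_iff := ?_ }
  · intro c x
    refine le_antisymm (hsm c x) ?_
    rcases eq_or_ne c 0 with rfl | hc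
    · simpa using hnn _
    · have h := hsm c⁻¹ (c • x)
      rw [smul_smul, inv_mul_cancel₀ hc, one_smul, norm_inv] at h
      have hc' : 0 < ‖c‖ := norm_pos_iff.2 hc
      calc ‖c‖ * ‖x‖ ≤ ‖c‖ * (‖c‖⁻¹ * ‖c • x‖) := mul_le_mul_of_nonneg_left h hc'.le
        _ = ‖c • x‖ := by field_simp
  · intro x y
    refine le_of_forall_pos_le_add fun ε hε => ?_
    obtain ⟨C, hC, hlt⟩ := happrox x (ε / 3) (by positivity)
    obtain ⟨D, hD, hlt'⟩ := happrox y (ε / 3) (by positivity)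
    obtain ⟨B, hB, hPB⟩ := hadd x y C D hC hD (ε / 3) (by positivity)
    have := hle _ _ hPB
    linarith
  · intro x
    constructor
    · intro hx
      have h := hKx x
      rw [hx, mul_zero] at h
      exact hι (by rw [map_zero]; exact norm_le_zero_iff.1 h)
    · rintro rfl
      have h := hsm 0 (0 : V)
      rw [smul_zero, norm_zero, zero_mul] at h
      exact le_antisymm h (hnn _)

/-! ### The complex interpolation method -/

section Interpolation

variable {A₀ A₁ X : Type*} [NormedAddCommGroup A₀] [NormedSpace ℂ A₀]
  [NormedAddCommGroup A₁] [NormedSpace ℂ A₁] [NormedAddCommGroup X] [NormedSpace ℂ X]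

/-- Let `i₀ : A₀ → X` and `i₁ : A₁ → X` be the (continuous) inclusions of the two members of a
couple. The function `f`, with boundary functions `g₀ t = f (it)` and `g₁ t = f (1 + it)`, belongs
to Calderón's space `𝓕(A₀, A₁)`: `f` is bounded and continuous on the closed strip
`0 ≤ Re z ≤ 1`, holomorphic in its interior, and its boundary values on `Re z = j` form
a continuous function with values in `A_j`, which tends to zero at infinity. -/
structure IsAdmissible (i₀ : A₀ →L[ℂ] X) (i₁ : A₁ →L[ℂ] X) (f : ℂ → X)
    (g₀ : C₀(ℝ, A₀)) (g₁ : C₀(ℝ, A₁)) : Prop where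
  diffContOnCl : DiffContOnCl ℂ f (re ⁻¹' Ioo 0 1)
  bounded : ∃ M : ℝ, ∀ z : ℂ, 0 ≤ z.re → z.re ≤ 1 → ‖f z‖ ≤ M
  left : ∀ t : ℝ, f (t * I) = i₀ (g₀ t)
  right : ∀ t : ℝ, f (1 + t * I) = i₁ (g₁ t)

/-- `C` is the norm in `𝓕(A₀, A₁)` of a function whose value at `θ` is `x`. -/
def IsInterpBound (θ : Ioo (0 : ℝ) 1) (i₀ : A₀ →L[ℂ] X) (i₁ : A₁ →L[ℂ] X) (x : X) (C : ℝ) : Prop :=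
  ∃ (f : ℂ → X) (g₀ : C₀(ℝ, A₀)) (g₁ : C₀(ℝ, A₁)),
    IsAdmissible i₀ i₁ f g₀ g₁ ∧ f ((θ : ℝ) : ℂ) = x ∧ C = max ‖g₀‖ ‖g₁‖

theorem C0_norm_apply_le {A : Type*} [NormedAddCommGroup A] (g : C₀(ℝ, A)) (t : ℝ) :
    ‖g t‖ ≤ ‖g‖ := by
  rw [← ZeroAtInftyContinuousMap.norm_toBCF_eq_norm]
  exact g.toBCF.norm_coe_le_norm t

theorem IsAdmissible.zero (i₀ : A₀ →L[ℂ] X) (i₁ : A₁ →L[ℂ] X) :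
    IsAdmissible i₀ i₁ 0 0 0 where
  diffContOnCl := diffContOnCl_const
  bounded := ⟨0, fun z _ _ => by simp⟩
  left t := by simp
  right t := by simp

theorem IsAdmissible.add {i₀ : A₀ →L[ℂ] X} {i₁ : A₁ →L[ℂ] X} {f f' : ℂ → X}
    {g₀ g₀' : C₀(ℝ, A₀)} {g₁ g₁' : C₀(ℝ, A₁)} (h : IsAdmissible i₀ i₁ f g₀ g₁)
    (h' : IsAdmissible i₀ i₁ f' g₀' g₁') :
    IsAdmissible i₀ i₁ (f + f') (g₀ + g₀') (g₁ + g₁') where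
  diffContOnCl := h.diffContOnCl.add h'.diffContOnCl
  bounded := by
    obtain ⟨M, hM⟩ := h.bounded
    obtain ⟨M', hM'⟩ := h'.bounded
    exact ⟨M + M', fun z h0 h1 =>
      (norm_add_le _ _).trans (add_le_add (hM z h0 h1) (hM' z h0 h1))⟩
  left t := by simp [h.left, h'.left]
  right t := by simp [h.right, h'.right]

theorem IsAdmissible.smul {i₀ : A₀ →L[ℂ] X} {i₁ : A₁ →L[ℂ] X} {f : ℂ → X}
    {g₀ : C₀(ℝ, A₀)} {g₁ : C₀(ℝ, A₁)} (c : ℂ) (h : IsAdmissible i₀ i₁ f g₀ g₁) :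
    IsAdmissible i₀ i₁ (c • f) (c • g₀) (c • g₁) where
  diffContOnCl := h.diffContOnCl.const_smul c
  bounded := by
    obtain ⟨M, hM⟩ := h.bounded
    refine ⟨‖c‖ * M, fun z h0 h1 => ?_⟩
    rw [Pi.smul_apply, norm_smul]
    exact mul_le_mul_of_nonneg_left (hM z h0 h1) (norm_nonneg c)
  left t := by simp [h.left]
  right t := by simp [h.right]

theorem IsInterpBound.nonneg {θ : Ioo (0 : ℝ) 1} {i₀ : A₀ →L[ℂ] X} {i₁ : A₁ →L[ℂ] X} {x : X}
    {C : ℝ} (h : IsInterpBound θ i₀ i₁ x C) : 0 ≤ C := by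
  obtain ⟨f, g₀, g₁, -, -, rfl⟩ := h
  exact (norm_nonneg _).trans (le_max_left _ _)

theorem IsInterpBound.zero (θ : Ioo (0 : ℝ) 1) (i₀ : A₀ →L[ℂ] X) (i₁ : A₁ →L[ℂ] X) :
    IsInterpBound θ i₀ i₁ 0 0 :=
  ⟨0, 0, 0, .zero i₀ i₁, rfl, by simp⟩

theorem IsInterpBound.add {θ : Ioo (0 : ℝ) 1} {i₀ : A₀ →L[ℂ] X} {i₁ : A₁ →L[ℂ] X} {x y : X}
    {C D : ℝ} (h : IsInterpBound θ i₀ i₁ x C) (h' : IsInterpBound θ i₀ i₁ y D) :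
    ∃ B ≤ C + D, IsInterpBound θ i₀ i₁ (x + y) B := by
  obtain ⟨f, g₀, g₁, hf, rfl, rfl⟩ := h
  obtain ⟨f', g₀', g₁', hf', rfl, rfl⟩ := h'
  refine ⟨_, ?_, f + f', g₀ + g₀', g₁ + g₁', hf.add hf', rfl, rfl⟩
  exact max_le
    ((norm_add_le _ _).trans (add_le_add (le_max_left _ _) (le_max_left _ _)))
    ((norm_add_le _ _).trans (add_le_add (le_max_right _ _) (le_max_right _ _)))

theorem IsInterpBound.smul {θ : Ioo (0 : ℝ) 1} {i₀ : A₀ →L[ℂ] X} {i₁ : A₁ →L[ℂ] X} {x : X}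
    {C : ℝ} (c : ℂ) (h : IsInterpBound θ i₀ i₁ x C) :
    ∃ B ≤ ‖c‖ * C, IsInterpBound θ i₀ i₁ (c • x) B := by
  obtain ⟨f, g₀, g₁, hf, rfl, rfl⟩ := h
  refine ⟨_, ?_, c • f, c • g₀, c • g₁, hf.smul c, rfl, rfl⟩
  rw [norm_smul, norm_smul, mul_max_of_nonneg _ _ (norm_nonneg c)]

theorem IsInterpBound.norm_le {θ : Ioo (0 : ℝ) 1} {i₀ : A₀ →L[ℂ] X} {i₁ : A₁ →L[ℂ] X} {x : X}
    {C : ℝ} (h : IsInterpBound θ i₀ i₁ x C) : ‖x‖ ≤ max ‖i₀‖ ‖i₁‖ * C := by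
  obtain ⟨f, g₀, g₁, hf, rfl, rfl⟩ := h
  obtain ⟨M, hM⟩ := hf.bounded
  refine PhragmenLindelof.vertical_strip hf.diffContOnCl ?_ ?_ ?_ ?_ ?_
  · refine ⟨0, by simpa using Real.pi_pos, 0, ?_⟩
    refine Asymptotics.IsBigO.of_bound M ?_
    refine Filter.Eventually.filter_mono inf_le_right ?_
    refine Filter.eventually_principal.2 fun z hz => ?_
    simpa using hM z hz.1.le hz.2.le
  · intro z hz
    have hz' : z = (z.im : ℂ) * I := by
      apply Complex.ext <;> simp [hz]
    rw [hz', hf.left]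
    calc ‖i₀ (g₀ z.im)‖ ≤ ‖i₀‖ * ‖g₀ z.im‖ := i₀.le_opNorm _
      _ ≤ max ‖i₀‖ ‖i₁‖ * max ‖g₀‖ ‖g₁‖ := by
        gcongr
        · exact le_max_left _ _
        · exact (C0_norm_apply_le g₀ _).trans (le_max_left _ _)
  · intro z hz
    have hz' : z = 1 + (z.im : ℂ) * I := by
      apply Complex.ext <;> simp [hz]
    rw [hz', hf.right]
    calc ‖i₁ (g₁ z.im)‖ ≤ ‖i₁‖ * ‖g₁ z.im‖ := i₁.le_opNorm _
      _ ≤ max ‖i₀‖ ‖i₁‖ * max ‖g₀‖ ‖g₁‖ := by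
        gcongr
        · exact le_max_right _ _
        · exact (C0_norm_apply_le g₁ _).trans (le_max_right _ _)
  · simpa using θ.2.1.le
  · simpa using θ.2.2.le

/-- The underlying vector space of `[A₀, A₁]_θ`: the values `f θ` for `f` in `𝓕(A₀, A₁)`. -/
def interpSubmodule (θ : Ioo (0 : ℝ) 1) (i₀ : A₀ →L[ℂ] X) (i₁ : A₁ →L[ℂ] X) : Submodule ℂ X where
  carrier := {x | ∃ C, IsInterpBound θ i₀ i₁ x C}
  zero_mem' := ⟨0, .zero θ i₀ i₁⟩
  add_mem' := by
    rintro x y ⟨C, hC⟩ ⟨D, hD⟩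
    obtain ⟨B, -, hB⟩ := hC.add hD
    exact ⟨B, hB⟩
  smul_mem' := by
    rintro c x ⟨C, hC⟩
    obtain ⟨B, -, hB⟩ := hC.smul c
    exact ⟨B, hB⟩

/-- The complex interpolation space `[A₀, A₁]_θ`, `0 < θ < 1`, of the couple given by the
inclusions `i₀ : A₀ → X` and `i₁ : A₁ → X`. It carries the interpolation norm (below), not the norm
of `X`. -/
def Interp (θ : Ioo (0 : ℝ) 1) (i₀ : A₀ →L[ℂ] X) (i₁ : A₁ →L[ℂ] X) : Type _ :=
  interpSubmodule θ i₀ i₁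

namespace Interp

variable (θ : Ioo (0 : ℝ) 1) (i₀ : A₀ →L[ℂ] X) (i₁ : A₁ →L[ℂ] X)

instance : AddCommGroup (Interp θ i₀ i₁) :=
  inferInstanceAs (AddCommGroup (interpSubmodule θ i₀ i₁))

instance : Module ℂ (Interp θ i₀ i₁) :=
  inferInstanceAs (Module ℂ (interpSubmodule θ i₀ i₁))

/-- The inclusion of `[A₀, A₁]_θ` into `X`, as a linear map. -/
def inclₗ : Interp θ i₀ i₁ →ₗ[ℂ] X := (interpSubmodule θ i₀ i₁).subtype

/-- `‖x‖_θ = inf {‖f‖ : f ∈ 𝓕(A₀, A₁), f θ = x}`. -/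
instance : Norm (Interp θ i₀ i₁) where
  norm x := sInf {C : ℝ | IsInterpBound θ i₀ i₁ (inclₗ θ i₀ i₁ x) C}

theorem core : NormedSpace.Core ℂ (Interp θ i₀ i₁) := by
  refine infNorm_core (fun x C => IsInterpBound θ i₀ i₁ (inclₗ θ i₀ i₁ x) C) (fun _ => rfl)
    (fun x => x.2) (fun x C h => h.nonneg) ?_ ?_ (inclₗ θ i₀ i₁) Subtype.val_injective
    (max ‖i₀‖ ‖i₁‖) (fun x C h => h.norm_le)
  · intro x y C D hC hD ε hε
    obtain ⟨B, hB, h⟩ := hC.add hD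
    exact ⟨B, by linarith, by rwa [map_add]⟩
  · intro c x C hC
    obtain ⟨B, hB, h⟩ := hC.smul c
    exact ⟨B, hB, by rwa [map_smul]⟩

instance : NormedAddCommGroup (Interp θ i₀ i₁) := NormedAddCommGroup.ofCore (core θ i₀ i₁)

instance : NormedSpace ℂ (Interp θ i₀ i₁) := NormedSpace.ofCore (core θ i₀ i₁)

/-- The (continuous) inclusion of `[A₀, A₁]_θ` into `X`. -/
def incl : Interp θ i₀ i₁ →L[ℂ] X :=
  (inclₗ θ i₀ i₁).mkContinuous (max ‖i₀‖ ‖i₁‖) fun x => by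
    change _ ≤ _ * sInf {C : ℝ | IsInterpBound θ i₀ i₁ (inclₗ θ i₀ i₁ x) C}
    rcases (le_max_of_le_left (norm_nonneg i₀) : 0 ≤ max ‖i₀‖ ‖i₁‖).eq_or_lt with h0 | hpos
    · obtain ⟨C, hC⟩ := x.2
      have h := IsInterpBound.norm_le hC
      rw [← h0, zero_mul] at h ⊢
      exact h
    · rw [← div_le_iff₀' hpos]
      exact le_csInf x.2 fun C hC => (div_le_iff₀' hpos).2 hC.norm_le

end Interp

end Interpolation

/-! ### Operators factoring through a Hilbert space -/

section Gamma2

variable {A : Type u} {B : Type v} [NormedAddCommGroup A] [NormedSpace ℂ A]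
  [NormedAddCommGroup B] [NormedSpace ℂ B]

/-- `T = R S` is a factorization of `T` through a Hilbert space `H` with `C = ‖R‖ ‖S‖`.
(Replacing `H` by the closure of the range of `S`, one sees that Hilbert spaces in the universe of
`A` are enough.) -/
def IsGamma2Bound (T : A →L[ℂ] B) (C : ℝ) : Prop :=
  ∃ (H : Type u) (_ : NormedAddCommGroup H) (_ : InnerProductSpace ℂ H) (_ : CompleteSpace H)
    (R : H →L[ℂ] B) (S : A →L[ℂ] H), T = R ∘L S ∧ C = ‖R‖ * ‖S‖

theorem IsGamma2Bound.nonneg {T : A →L[ℂ] B} {C : ℝ} (h : IsGamma2Bound T C) : 0 ≤ C := by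
  obtain ⟨H, _, _, _, R, S, -, rfl⟩ := h
  positivity

theorem IsGamma2Bound.norm_le {T : A →L[ℂ] B} {C : ℝ} (h : IsGamma2Bound T C) : ‖T‖ ≤ C := by
  obtain ⟨H, _, _, _, R, S, rfl, rfl⟩ := h
  exact R.opNorm_comp_le S

theorem IsGamma2Bound.zero : IsGamma2Bound (0 : A →L[ℂ] B) 0 :=
  ⟨PUnit, inferInstance, inferInstance, inferInstance, 0, 0, by simp, by simp⟩

theorem IsGamma2Bound.smul {T : A →L[ℂ] B} {C : ℝ} (c : ℂ) (h : IsGamma2Bound T C) :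
    IsGamma2Bound (c • T) (‖c‖ * C) := by
  obtain ⟨H, _, _, _, R, S, rfl, rfl⟩ := h
  exact ⟨H, _, _, ‹_›, c • R, S, by simp, by rw [norm_smul, mul_assoc]⟩

theorem IsGamma2Bound.balanced {T : A →L[ℂ] B} {C c : ℝ} (h : IsGamma2Bound T C) (hC : C < c) :
    ∃ (H : Type u) (_ : NormedAddCommGroup H) (_ : InnerProductSpace ℂ H) (_ : CompleteSpace H)
      (R : H →L[ℂ] B) (S : A →L[ℂ] H), T = R ∘L S ∧ ‖R‖ ≤ √c ∧ ‖S‖ ≤ √c := by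
  have hc : 0 < c := h.nonneg.trans_lt hC
  obtain ⟨H, _, _, _, R, S, rfl, rfl⟩ := h
  have hs : 0 < √c := Real.sqrt_pos.2 hc
  rcases (norm_nonneg S).eq_or_lt with h0 | hS
  · have : S = 0 := norm_eq_zero.1 h0.symm
    exact ⟨H, _, _, ‹_›, 0, 0, by simp [this], by simp, by simp⟩
  · have hcs : √c * √c = c := Real.mul_self_sqrt hc.le
    refine ⟨H, _, _, ‹_›, ((‖S‖ / √c : ℝ) : ℂ) • R, ((√c / ‖S‖ : ℝ) : ℂ) • S, ?_, ?_, ?_⟩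
    · rw [ContinuousLinearMap.smul_comp, ContinuousLinearMap.comp_smul, smul_smul, ← ofReal_mul,
        div_mul_div_cancel₀ hs.ne', div_self hS.ne', ofReal_one, one_smul]
    · rw [norm_smul, norm_real, Real.norm_of_nonneg (by positivity), div_mul_eq_mul_div,
        div_le_iff₀ hs, hcs, mul_comm]
      exact hC.le
    · rw [norm_smul, norm_real, Real.norm_of_nonneg (by positivity), div_mul_cancel₀ _ hS.ne']

theorem IsGamma2Bound.add {T T' : A →L[ℂ] B} {C D : ℝ} (h : IsGamma2Bound T C)
    (h' : IsGamma2Bound T' D) {ε : ℝ} (hε : 0 < ε) :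
    ∃ M ≤ C + D + ε, IsGamma2Bound (T + T') M := by
  set c := C + ε / 2 with hcdef
  set d := D + ε / 2 with hddef
  have hc : 0 ≤ c := by have := h.nonneg; positivity
  have hd : 0 ≤ d := by have := h'.nonneg; positivity
  obtain ⟨H, _, _, _, R, S, rfl, hR, hS⟩ := h.balanced (show C < c by linarith)
  obtain ⟨H', _, _, _, R', S', rfl, hR', hS'⟩ := h'.balanced (show D < d by linarith)
  let e := WithLp.prodContinuousLinearEquiv 2 ℂ H H'
  let R₁ : WithLp 2 (H × H') →L[ℂ] B := (R.coprod R') ∘L (e : WithLp 2 (H × H') →L[ℂ] H × H')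
  let S₁ : A →L[ℂ] WithLp 2 (H × H') := (e.symm : H × H' →L[ℂ] WithLp 2 (H × H')) ∘L (S.prod S')
  have hcd : √(c + d) * √(c + d) = c + d := Real.mul_self_sqrt (by positivity)
  have hcc : √c * √c = c := Real.mul_self_sqrt hc
  have hdd : √d * √d = d := Real.mul_self_sqrt hd
  have hR₁ : ‖R₁‖ ≤ √(c + d) := by
    refine R₁.opNorm_le_bound (Real.sqrt_nonneg _) fun x => ?_
    have h1 : ‖R₁ x‖ ≤ √c * ‖x.fst‖ + √d * ‖x.snd‖ :=
      calc ‖R x.fst + R' x.snd‖ ≤ ‖R x.fst‖ + ‖R' x.snd‖ := norm_add_le _ _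
        _ ≤ √c * ‖x.fst‖ + √d * ‖x.snd‖ :=
          add_le_add (R.le_of_opNorm_le hR _) (R'.le_of_opNorm_le hR' _)
    have h2 : ‖x‖ ^ 2 = ‖x.fst‖ ^ 2 + ‖x.snd‖ ^ 2 := WithLp.prod_norm_sq_eq_of_L2 x
    refine h1.trans (abs_le_of_sq_le_sq' ?_ (by positivity)).2
    rw [mul_pow, Real.sq_sqrt (by positivity), h2]
    nlinarith [sq_nonneg (√c * ‖x.snd‖ - √d * ‖x.fst‖), Real.sq_sqrt hc, Real.sq_sqrt hd]
  have hS₁ : ‖S₁‖ ≤ √(c + d) := by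
    refine S₁.opNorm_le_bound (Real.sqrt_nonneg _) fun x => ?_
    have h2 : ‖S₁ x‖ ^ 2 = ‖S x‖ ^ 2 + ‖S' x‖ ^ 2 := WithLp.prod_norm_sq_eq_of_L2 _
    refine (abs_le_of_sq_le_sq' ?_ (by positivity)).2
    have h3 := S.le_of_opNorm_le hS x
    have h4 := S'.le_of_opNorm_le hS' x
    rw [mul_pow, Real.sq_sqrt (by positivity), h2, add_mul]
    refine add_le_add ?_ ?_
    · calc ‖S x‖ ^ 2 ≤ (√c * ‖x‖) ^ 2 := by gcongr
        _ = c * ‖x‖ ^ 2 := by rw [mul_pow, Real.sq_sqrt hc]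
    · calc ‖S' x‖ ^ 2 ≤ (√d * ‖x‖) ^ 2 := by gcongr
        _ = d * ‖x‖ ^ 2 := by rw [mul_pow, Real.sq_sqrt hd]
  have hT : R ∘L S + R' ∘L S' = R₁ ∘L S₁ := by
    ext x
    simp [R₁, S₁, e]
  refine ⟨‖R₁‖ * ‖S₁‖, ?_, WithLp 2 (H × H'), inferInstance, inferInstance, inferInstance,
    R₁, S₁, hT, rfl⟩
  calc ‖R₁‖ * ‖S₁‖ ≤ √(c + d) * √(c + d) := by gcongr
    _ = C + D + ε := by rw [hcd, hcdef, hddef]; ring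

variable (A B) in
/-- The underlying vector space of `Γ₂(A, B)`. -/
def gamma2Submodule : Submodule ℂ (A →L[ℂ] B) where
  carrier := {T | ∃ C, IsGamma2Bound T C}
  zero_mem' := ⟨0, .zero⟩
  add_mem' := by
    rintro S T ⟨C, hC⟩ ⟨D, hD⟩
    obtain ⟨M, -, hM⟩ := hC.add hD one_pos
    exact ⟨M, hM⟩
  smul_mem' := by
    rintro c T ⟨C, hC⟩
    exact ⟨_, hC.smul c⟩

variable (A B) in
/-- `Γ₂(A, B)`: the operators from `A` to `B` that factor through a Hilbert space. It carries the
norm `γ₂` (below), not the operator norm. -/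
def Gamma2 : Type _ := gamma2Submodule A B

namespace Gamma2

instance : AddCommGroup (Gamma2 A B) := inferInstanceAs (AddCommGroup (gamma2Submodule A B))

instance : Module ℂ (Gamma2 A B) := inferInstanceAs (Module ℂ (gamma2Submodule A B))

variable (A B) in
/-- The inclusion of `Γ₂(A, B)` into the space of all bounded operators, as a linear map. -/
def inclₗ : Gamma2 A B →ₗ[ℂ] (A →L[ℂ] B) := (gamma2Submodule A B).subtype

/-- `γ₂(T) = inf {‖R‖ ‖S‖ : T = R S is a factorization through a Hilbert space}`. -/
instance : Norm (Gamma2 A B) where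
  norm T := sInf {C : ℝ | IsGamma2Bound (inclₗ A B T) C}

variable (A B) in
theorem core : NormedSpace.Core ℂ (Gamma2 A B) := by
  refine infNorm_core (fun T C => IsGamma2Bound (inclₗ A B T) C) (fun _ => rfl)
    (fun T => T.2) (fun T C h => h.nonneg) ?_ ?_ (inclₗ A B) Subtype.val_injective
    1 (fun T C h => by simpa using h.norm_le)
  · intro S T C D hC hD ε hε
    obtain ⟨M, hM, h⟩ := hC.add hD hε
    exact ⟨M, hM, by rwa [map_add]⟩
  · intro c T C hC
    exact ⟨_, le_rfl, by rw [map_smul]; exact hC.smul c⟩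

instance : NormedAddCommGroup (Gamma2 A B) := NormedAddCommGroup.ofCore (core A B)

instance : NormedSpace ℂ (Gamma2 A B) := NormedSpace.ofCore (core A B)

variable (A B) in
/-- The (continuous) inclusion of `Γ₂(A, B)` into the space of all bounded operators. -/
def incl : Gamma2 A B →L[ℂ] (A →L[ℂ] B) :=
  (inclₗ A B).mkContinuous 1 fun T => by
    rw [one_mul]
    exact le_csInf T.2 fun C hC => hC.norm_le

end Gamma2

end Gamma2

/-! ### Norms of embeddings, and the quantities in the theorem -/

/-- The norm of the embedding `P ↪ Q` of two normed spaces sitting, via `p` and `q`, inside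
a common space `X`: the smallest `C` such that every element `x` of `P` belongs to `Q` and has norm
at most `C ‖x‖` there. It is `∞` if there is no bounded embedding. -/
def embeddingNorm {P Q X : Type*} [NormedAddCommGroup P] [NormedAddCommGroup Q]
    (p : P → X) (q : Q → X) : ℝ≥0∞ :=
  sInf {C : ℝ≥0∞ | ∀ x : P, ∃ y : Q, q y = p x ∧ ‖y‖ₑ ≤ C * ‖x‖ₑ}

/-- The Hilbert space `ℓ₂` of square summable complex sequences. -/
abbrev Ell2 : Type := lp (fun _ : ℕ => ℂ) 2

section Couples

variable {E₀ E₁ E : Type*} [NormedAddCommGroup E₀] [NormedSpace ℂ E₀] [NormedAddCommGroup E₁]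
  [NormedSpace ℂ E₁] [NormedAddCommGroup E] [NormedSpace ℂ E]

/-- The inclusions `i₀ : E₀ → E` and `i₁ : E₁ → E` make `[E₀, E₁]` a finite-dimensional
interpolation couple: both spaces embed into the ambient space `E` and have the same finite
dimension. -/
structure IsFinDimCouple (i₀ : E₀ →L[ℂ] E) (i₁ : E₁ →L[ℂ] E) : Prop where
  finite_left : FiniteDimensional ℂ E₀
  finite_right : FiniteDimensional ℂ E₁
  finrank_eq : Module.finrank ℂ E₀ = Module.finrank ℂ E₁
  injective_left : Function.Injective i₀
  injective_right : Function.Injective i₁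

/-- `d_θ[E₀, E₁]`, the norm of the embedding of `𝓛(ℓ₂, [E₀, E₁]_θ)` into
`[𝓛(ℓ₂, E₀), 𝓛(ℓ₂, E₁)]_θ`; all the operator spaces are regarded as subspaces of `𝓛(ℓ₂, E)`. -/
def dTheta (θ : Ioo (0 : ℝ) 1) (i₀ : E₀ →L[ℂ] E) (i₁ : E₁ →L[ℂ] E) : ℝ≥0∞ :=
  embeddingNorm
    (fun T : Ell2 →L[ℂ] Interp θ i₀ i₁ => Interp.incl θ i₀ i₁ ∘L T)
    (Interp.incl θ (ContinuousLinearMap.compL ℂ Ell2 E₀ E i₀)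
      (ContinuousLinearMap.compL ℂ Ell2 E₁ E i₁))

/-- The restriction map `E' → G'` of a subspace `i : G → E`. -/
def dualRestrict {G : Type*} [NormedAddCommGroup G] [NormedSpace ℂ G] (i : G →L[ℂ] E) :
    StrongDual ℂ E →L[ℂ] StrongDual ℂ G :=
  i.precomp ℂ

/-- For subspaces `i : G → E` and `j : K → F`, the space `Γ₂(G', K)` as a space of operators
from `E'` to `F`: the operator `T` is regarded as `E' → G' → K → F`. -/
def Gamma2.ambient {G K F : Type*} [NormedAddCommGroup G] [NormedSpace ℂ G]
    [NormedAddCommGroup K] [NormedSpace ℂ K] [NormedAddCommGroup F] [NormedSpace ℂ F]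
    (i : G →L[ℂ] E) (j : K →L[ℂ] F) :
    Gamma2 (StrongDual ℂ G) K →L[ℂ] (StrongDual ℂ E →L[ℂ] F) :=
  j.postcomp (StrongDual ℂ E) ∘L (dualRestrict i).precomp K ∘L
    Gamma2.incl (StrongDual ℂ G) K

end Couples

end

noncomputable section

set_option maxSynthPendingDepth 3

/-! ### Elements of interpolation spaces -/

section Interpolation

variable {A₀ A₁ X : Type*} [NormedAddCommGroup A₀] [NormedSpace ℂ A₀]
  [NormedAddCommGroup A₁] [NormedSpace ℂ A₁] [NormedAddCommGroup X] [NormedSpace ℂ X]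
  {B₀ B₁ Y : Type*} [NormedAddCommGroup B₀] [NormedSpace ℂ B₀]
  [NormedAddCommGroup B₁] [NormedSpace ℂ B₁] [NormedAddCommGroup Y] [NormedSpace ℂ Y]
  {D₀ D₁ Z : Type*} [NormedAddCommGroup D₀] [NormedSpace ℂ D₀]
  [NormedAddCommGroup D₁] [NormedSpace ℂ D₁] [NormedAddCommGroup Z] [NormedSpace ℂ Z]
  {θ : Ioo (0 : ℝ) 1}

/-! Write `G = [E₀, E₁]_θ` and `K = [F₀, F₁]_θ`. Since `G` is finite-dimensional, a factorization of
`T : G' → K` through a Hilbert space can be moved to `ℓ₂` without loss and its first factor is a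
transpose: `T = g fᵗ` with `f : ℓ₂ → G`, `g : ℓ₂ → K` and `‖f‖ ‖g‖` close to `γ₂(T)`
(`IsGamma2Bound.exists_compTranspose`). By the definition of `d_θ`, `f` and `g` lie in the
interpolation spaces of the couples `𝓛(ℓ₂, E_j)` and `𝓛(ℓ₂, F_j)`, with norms enlarged by at most
the two factors `d_θ`. The bilinear map `(f, g) ↦ g fᵗ` is a contraction from `𝓛(ℓ₂, E_j) × 𝓛(ℓ₂,
F_j)` to `Γ₂(E_j', F_j)` for `j = 0, 1` (`exists_gamma2_compTranspose`), so bilinear interpolation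
(`Interp.exists_bilin`) gives the estimate.

Finiteness of `d_θ` (`dTheta_ne_top`) is qualitative: `G` embeds in `E₀`, and an operator into `G`,
expanded in a basis of `G`, is a finite sum of rank-one operators, each of which interpolates. -/

theorem Interp.incl_injective (i₀ : A₀ →L[ℂ] X) (i₁ : A₁ →L[ℂ] X) :
    Function.Injective (Interp.incl θ i₀ i₁) :=
  Subtype.val_injective

theorem IsInterpBound.exists_interp {i₀ : A₀ →L[ℂ] X} {i₁ : A₁ →L[ℂ] X} {x : X} {C : ℝ}
    (h : IsInterpBound θ i₀ i₁ x C) :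
    ∃ y : Interp θ i₀ i₁, Interp.incl θ i₀ i₁ y = x ∧ ‖y‖ ≤ C :=
  ⟨⟨x, C, h⟩, rfl, csInf_le ⟨0, fun _ hD => IsInterpBound.nonneg hD⟩ h⟩

theorem Interp.exists_bound_lt {i₀ : A₀ →L[ℂ] X} {i₁ : A₁ →L[ℂ] X} (y : Interp θ i₀ i₁) {c : ℝ}
    (hc : ‖y‖ < c) : ∃ C < c, IsInterpBound θ i₀ i₁ (Interp.incl θ i₀ i₁ y) C := by
  obtain ⟨C, hC, hlt⟩ := exists_lt_of_csInf_lt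
    (s := {C : ℝ | IsInterpBound θ i₀ i₁ (Interp.inclₗ θ i₀ i₁ y) C}) y.2 hc
  exact ⟨C, hlt, hC⟩

theorem ZeroAtInftyContinuousMap.norm_le_of_forall {A : Type*} [NormedAddCommGroup A]
    (g : C₀(ℝ, A)) {C : ℝ} (hC : 0 ≤ C) (h : ∀ t, ‖g t‖ ≤ C) : ‖g‖ ≤ C := by
  rw [← ZeroAtInftyContinuousMap.norm_toBCF_eq_norm]
  exact (BoundedContinuousFunction.norm_le hC).2 h

/-- The pointwise image of two functions vanishing at infinity under a bounded bilinear map. -/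
def ZeroAtInftyContinuousMap.bilin (b : A₀ →L[ℂ] B₀ →L[ℂ] D₀) (g : C₀(ℝ, A₀)) (h : C₀(ℝ, B₀)) :
    C₀(ℝ, D₀) where
  toFun t := b (g t) (h t)
  continuous_toFun := by
    have hg : Continuous g := g.continuous
    have hh : Continuous h := h.continuous
    fun_prop
  zero_at_infty' := by
    have h1 := g.zero_at_infty'
    have h2 := h.zero_at_infty'
    have h3 : Filter.Tendsto (fun p : A₀ × B₀ => b p.1 p.2) (nhds (0, 0)) (nhds (b 0 0)) :=
      Continuous.tendsto (by fun_prop) ((0, 0) : A₀ × B₀)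
    rw [map_zero] at h3
    exact h3.comp (h1.prodMk_nhds h2)

theorem ZeroAtInftyContinuousMap.norm_bilin_le {b : A₀ →L[ℂ] B₀ →L[ℂ] D₀} (hb : ‖b‖ ≤ 1)
    (g : C₀(ℝ, A₀)) (h : C₀(ℝ, B₀)) : ‖bilin b g h‖ ≤ ‖g‖ * ‖h‖ := by
  refine norm_le_of_forall _ (by positivity) fun t => ?_
  calc ‖b (g t) (h t)‖ ≤ ‖b‖ * ‖g t‖ * ‖h t‖ := b.le_opNorm₂ _ _
    _ ≤ 1 * ‖g‖ * ‖h‖ := by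
      gcongr
      · exact C0_norm_apply_le g t
      · exact C0_norm_apply_le h t
    _ = ‖g‖ * ‖h‖ := by rw [one_mul]

/-- Bilinear complex interpolation. -/
theorem IsInterpBound.bilin {i₀ : A₀ →L[ℂ] X} {i₁ : A₁ →L[ℂ] X} {j₀ : B₀ →L[ℂ] Y}
    {j₁ : B₁ →L[ℂ] Y} {k₀ : D₀ →L[ℂ] Z} {k₁ : D₁ →L[ℂ] Z}
    (b₀ : A₀ →L[ℂ] B₀ →L[ℂ] D₀) (b₁ : A₁ →L[ℂ] B₁ →L[ℂ] D₁) (b : X →L[ℂ] Y →L[ℂ] Z)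
    (h₀ : ∀ x y, k₀ (b₀ x y) = b (i₀ x) (j₀ y)) (h₁ : ∀ x y, k₁ (b₁ x y) = b (i₁ x) (j₁ y))
    (hb₀ : ‖b₀‖ ≤ 1) (hb₁ : ‖b₁‖ ≤ 1) {x : X} {y : Y} {C D : ℝ}
    (hx : IsInterpBound θ i₀ i₁ x C) (hy : IsInterpBound θ j₀ j₁ y D) :
    ∃ M ≤ C * D, IsInterpBound θ k₀ k₁ (b x y) M := by
  obtain ⟨f, g₀, g₁, hf, rfl, rfl⟩ := hx
  obtain ⟨f', g₀', g₁', hf', rfl, rfl⟩ := hy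
  -- The product of the two functions under `b` is admissible; on each boundary line it is the
  -- product under `b₀` or `b₁`, so its norm is at most the product of the norms.
  refine ⟨_, ?_, fun z => b (f z) (f' z), .bilin b₀ g₀ g₀', .bilin b₁ g₁ g₁',
    ⟨⟨?_, ?_⟩, ?_, ?_, ?_⟩, rfl, rfl⟩
  · refine max_le ((ZeroAtInftyContinuousMap.norm_bilin_le hb₀ g₀ g₀').trans ?_) 
      ((ZeroAtInftyContinuousMap.norm_bilin_le hb₁ g₁ g₁').trans ?_)
    · gcongr
      exacts [le_max_left _ _, le_max_left _ _]
    · gcongr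
      exacts [le_max_right _ _, le_max_right _ _]
  · exact (b.differentiable.comp_differentiableOn hf.diffContOnCl.1).clm_apply hf'.diffContOnCl.1
  · exact (b.continuous.comp_continuousOn hf.diffContOnCl.2).clm_apply hf'.diffContOnCl.2
  · obtain ⟨M, hM⟩ := hf.bounded
    obtain ⟨M', hM'⟩ := hf'.bounded
    refine ⟨‖b‖ * M * M', fun z hz hz' => ?_⟩
    have hM0 : 0 ≤ M := (norm_nonneg _).trans (hM z hz hz')
    calc ‖b (f z) (f' z)‖ ≤ ‖b‖ * ‖f z‖ * ‖f' z‖ := b.le_opNorm₂ _ _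
      _ ≤ ‖b‖ * M * M' := by gcongr; exacts [hM z hz hz', hM' z hz hz']
  · intro t
    rw [hf.left, hf'.left, ← h₀]
    rfl
  · intro t
    rw [hf.right, hf'.right, ← h₁]
    rfl

/-- Complex interpolation of linear operators. -/
theorem IsInterpBound.map {i₀ : A₀ →L[ℂ] X} {i₁ : A₁ →L[ℂ] X} {j₀ : B₀ →L[ℂ] Y}
    {j₁ : B₁ →L[ℂ] Y} (b₀ : A₀ →L[ℂ] B₀) (b₁ : A₁ →L[ℂ] B₁) (b : X →L[ℂ] Y)
    (h₀ : ∀ x, j₀ (b₀ x) = b (i₀ x)) (h₁ : ∀ x, j₁ (b₁ x) = b (i₁ x)) {K : ℝ}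
    (hb₀ : ‖b₀‖ ≤ K) (hb₁ : ‖b₁‖ ≤ K) {x : X} {C : ℝ} (hx : IsInterpBound θ i₀ i₁ x C) :
    ∃ M ≤ K * C, IsInterpBound θ j₀ j₁ (b x) M := by
  have hK : 0 ≤ K := (norm_nonneg _).trans hb₀
  obtain ⟨f, g₀, g₁, hf, rfl, rfl⟩ := hx
  refine ⟨_, ?_, fun z => b (f z), ⟨⟨fun t => b₀ (g₀ t), b₀.continuous.comp g₀.continuous⟩,
      (b₀.continuous.tendsto' 0 0 (map_zero _)).comp g₀.zero_at_infty'⟩,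
    ⟨⟨fun t => b₁ (g₁ t), b₁.continuous.comp g₁.continuous⟩,
      (b₁.continuous.tendsto' 0 0 (map_zero _)).comp g₁.zero_at_infty'⟩,
    ⟨⟨?_, ?_⟩, ?_, ?_, ?_⟩, rfl, rfl⟩
  · have hpos : 0 ≤ K * max ‖g₀‖ ‖g₁‖ := by positivity
    refine max_le (ZeroAtInftyContinuousMap.norm_le_of_forall _ hpos fun t => ?_)
      (ZeroAtInftyContinuousMap.norm_le_of_forall _ hpos fun t => ?_)
    · exact b₀.le_of_opNorm_le_of_le hb₀ ((C0_norm_apply_le g₀ t).trans (le_max_left _ _))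
    · exact b₁.le_of_opNorm_le_of_le hb₁ ((C0_norm_apply_le g₁ t).trans (le_max_right _ _))
  · exact b.differentiable.comp_differentiableOn hf.diffContOnCl.1
  · exact b.continuous.comp_continuousOn hf.diffContOnCl.2
  · obtain ⟨M, hM⟩ := hf.bounded
    exact ⟨‖b‖ * M, fun z hz hz' => b.le_opNorm_of_le (hM z hz hz')⟩
  · intro t
    rw [hf.left, ← h₀]
    rfl
  · intro t
    rw [hf.right, ← h₁]
    rfl

theorem Interp.exists_bilin {i₀ : A₀ →L[ℂ] X} {i₁ : A₁ →L[ℂ] X} {j₀ : B₀ →L[ℂ] Y}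
    {j₁ : B₁ →L[ℂ] Y} {k₀ : D₀ →L[ℂ] Z} {k₁ : D₁ →L[ℂ] Z}
    (b₀ : A₀ →L[ℂ] B₀ →L[ℂ] D₀) (b₁ : A₁ →L[ℂ] B₁ →L[ℂ] D₁) (b : X →L[ℂ] Y →L[ℂ] Z)
    (h₀ : ∀ x y, k₀ (b₀ x y) = b (i₀ x) (j₀ y)) (h₁ : ∀ x y, k₁ (b₁ x y) = b (i₁ x) (j₁ y))
    (hb₀ : ‖b₀‖ ≤ 1) (hb₁ : ‖b₁‖ ≤ 1) (x : Interp θ i₀ i₁) (y : Interp θ j₀ j₁) :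
    ∃ w : Interp θ k₀ k₁, incl θ k₀ k₁ w = b (incl θ i₀ i₁ x) (incl θ j₀ j₁ y) ∧
      ‖w‖ ≤ ‖x‖ * ‖y‖ := by
  have h : ∀ c d, ‖x‖ < c → ‖y‖ < d → ∃ w : Interp θ k₀ k₁,
      incl θ k₀ k₁ w = b (incl θ i₀ i₁ x) (incl θ j₀ j₁ y) ∧ ‖w‖ ≤ c * d := by
    intro c d hc hd
    obtain ⟨C, hC, hx⟩ := x.exists_bound_lt hc
    obtain ⟨D, hD, hy⟩ := y.exists_bound_lt hd
    obtain ⟨M, hM, hxy⟩ := hx.bilin b₀ b₁ b h₀ h₁ hb₀ hb₁ hy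
    obtain ⟨w, hw, hwM⟩ := hxy.exists_interp
    exact ⟨w, hw, hwM.trans (hM.trans
      (mul_le_mul hC.le hD.le hy.nonneg ((norm_nonneg x).trans hc.le)))⟩
  -- The inclusion is injective, so the same `w` serves all `c` and `d`, and the infimum may be
  -- taken over both.
  obtain ⟨w, hw, -⟩ := h _ _ (lt_add_one _) (lt_add_one _)
  refine ⟨w, hw, le_mul_of_forall_lt₀ fun c hc d hd => ?_⟩
  obtain ⟨w', hw', hle⟩ := h c d hc hd
  rwa [incl_injective k₀ k₁ (hw.trans hw'.symm)]

/-- The summand `1` is slack that spares a limit argument; only the finiteness of `d_θ` depends on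
this bound. -/
theorem Interp.exists_map {i₀ : A₀ →L[ℂ] X} {i₁ : A₁ →L[ℂ] X} {j₀ : B₀ →L[ℂ] Y}
    {j₁ : B₁ →L[ℂ] Y} (b₀ : A₀ →L[ℂ] B₀) (b₁ : A₁ →L[ℂ] B₁) (b : X →L[ℂ] Y)
    (h₀ : ∀ x, j₀ (b₀ x) = b (i₀ x)) (h₁ : ∀ x, j₁ (b₁ x) = b (i₁ x)) {K : ℝ}
    (hb₀ : ‖b₀‖ ≤ K) (hb₁ : ‖b₁‖ ≤ K) (x : Interp θ i₀ i₁) :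
    ∃ y : Interp θ j₀ j₁, incl θ j₀ j₁ y = b (incl θ i₀ i₁ x) ∧ ‖y‖ ≤ K * (‖x‖ + 1) := by
  obtain ⟨C, hC, hx⟩ := x.exists_bound_lt (lt_add_one _)
  obtain ⟨M, hM, hxy⟩ := hx.map b₀ b₁ b h₀ h₁ hb₀ hb₁
  obtain ⟨w, hw, hwM⟩ := hxy.exists_interp
  exact ⟨w, hw, hwM.trans (hM.trans
    (mul_le_mul_of_nonneg_left hC.le ((norm_nonneg _).trans hb₀)))⟩

/-- If `A₀` is finite-dimensional, then all values of a function in `𝓕(A₀, A₁)` belong to `A₀`. -/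
theorem Interp.incl_mem_range_left [FiniteDimensional ℂ A₀] (i₀ : A₀ →L[ℂ] X) (i₁ : A₁ →L[ℂ] X)
    (x : Interp θ i₀ i₁) : incl θ i₀ i₁ x ∈ LinearMap.range i₀.toLinearMap := by
  obtain ⟨C, -, f, g₀, g₁, hf, hx, -⟩ := x.exists_bound_lt (lt_add_one _)
  rw [← hx]
  set V := LinearMap.range i₀.toLinearMap with hV
  -- Closedness makes `X ⧸ V` a normed space, so a class of norm zero is zero.
  have : IsClosed (V : Set X) := V.closed_of_finiteDimensional
  obtain ⟨M, hM⟩ := hf.bounded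
  have hq : ∀ z : ℂ, 0 ≤ z.re → z.re ≤ 1 → ‖V.mkQL (f z)‖ ≤ ‖V.mkQL‖ * M := fun z h h' =>
    V.mkQL.le_opNorm_of_le (hM z h h')
  -- Modulo `V` the function vanishes on `Re z = 0`, whence `a = 0`. The three lines theorem bounds
  -- its value at `θ` by `0 ^ (1 - θ) * b ^ θ`, which is zero because `θ < 1`.
  have hθ := Complex.HadamardThreeLines.norm_le_interp_of_mem_verticalClosedStrip₀₁'
    (f := fun z => V.mkQL (f z)) (z := ((θ : ℝ) : ℂ)) (a := 0) (b := ‖V.mkQL‖ * M)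
    ⟨by simpa using θ.2.1.le, by simpa using θ.2.2.le⟩
    ⟨V.mkQL.differentiable.comp_differentiableOn hf.diffContOnCl.1,
      V.mkQL.continuous.comp_continuousOn hf.diffContOnCl.2⟩
    ⟨‖V.mkQL‖ * M, by rintro _ ⟨z, hz, rfl⟩; exact hq z hz.1 hz.2⟩
    (fun z hz => ?_) (fun z hz => hq z (by simp [show z.re = 1 from hz])
      (by simp [show z.re = 1 from hz]))
  · rw [ofReal_re, Real.zero_rpow (by linarith [θ.2.2]), zero_mul] at hθ
    exact (Submodule.Quotient.mk_eq_zero V).1 (norm_le_zero_iff.1 hθ)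
  · have hz' : z = (z.im : ℂ) * I := by
      apply Complex.ext <;> simp [show z.re = 0 from hz]
    have hmem : f z ∈ V := by
      rw [hz', hf.left]
      exact ⟨_, rfl⟩
    exact (norm_le_zero_iff.2 ((Submodule.Quotient.mk_eq_zero V).2 hmem))

theorem Interp.finiteDimensional [FiniteDimensional ℂ A₀] (i₀ : A₀ →L[ℂ] X) (i₁ : A₁ →L[ℂ] X) :
    FiniteDimensional ℂ (Interp θ i₀ i₁) :=
  Module.Finite.of_injective
    ((Interp.incl θ i₀ i₁).toLinearMap.codRestrict _ (incl_mem_range_left i₀ i₁))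
    fun _ _ hxy => incl_injective i₀ i₁
      (congrArg (Subtype.val : LinearMap.range i₀.toLinearMap → X) hxy)

end Interpolation

/-! ### Embedding norms -/

section EmbeddingNorm

variable {P Q X : Type*} [NormedAddCommGroup P] [NormedAddCommGroup Q] {p : P → X} {q : Q → X}

theorem embeddingNorm_le_ofReal {C : ℝ} (hC : 0 ≤ C)
    (h : ∀ x, ∃ y, q y = p x ∧ ‖y‖ ≤ C * ‖x‖) : embeddingNorm p q ≤ ENNReal.ofReal C := by
  refine sInf_le fun x => ?_
  obtain ⟨y, hy, hle⟩ := h x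
  refine ⟨y, hy, ?_⟩
  rw [← ofReal_norm, ← ofReal_norm, ← ENNReal.ofReal_mul hC]
  exact ENNReal.ofReal_le_ofReal hle

/-- The norm of an embedding is attained. -/
theorem exists_norm_le_embeddingNorm (hq : Function.Injective q) (h : embeddingNorm p q ≠ ⊤)
    (x : P) : ∃ y, q y = p x ∧ ‖y‖ ≤ (embeddingNorm p q).toReal * ‖x‖ := by
  have key : ∀ c, (embeddingNorm p q).toReal < c → ∃ y, q y = p x ∧ ‖y‖ ≤ c * ‖x‖ := by
    intro c hc
    obtain ⟨C, hC, hlt⟩ := sInf_lt_iff.1 ((ENNReal.lt_ofReal_iff_toReal_lt h).2 hc)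
    obtain ⟨y, hy, hle⟩ := hC x
    refine ⟨y, hy, ?_⟩
    have h1 : ‖y‖ₑ ≤ ENNReal.ofReal c * ‖x‖ₑ := hle.trans (by gcongr)
    have hc0 : 0 ≤ c := ENNReal.toReal_nonneg.trans hc.le
    rw [← ofReal_norm, ← ofReal_norm, ← ENNReal.ofReal_mul hc0] at h1
    exact (ENNReal.ofReal_le_ofReal_iff (by positivity)).1 h1
  obtain ⟨y, hy, -⟩ := key _ (lt_add_one _)
  refine ⟨y, hy, ?_⟩
  have key' : ∀ c, (embeddingNorm p q).toReal < c → ‖y‖ ≤ c * ‖x‖ := by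
    intro c hc
    obtain ⟨y', hy', hle⟩ := key c hc
    rwa [hq (hy.trans hy'.symm)]
  -- If `‖x‖ = 0`, a single `c` already gives `‖y‖ ≤ 0`; otherwise divide by `‖x‖` and let `c`
  -- decrease to the embedding norm.
  rcases (norm_nonneg x).eq_or_lt with h0 | hpos
  · simpa [← h0] using key' _ (lt_add_one _)
  · rw [← div_le_iff₀ hpos]
    exact le_of_forall_gt_imp_ge_of_dense fun c hc => (div_le_iff₀ hpos).2 (key' c hc)

end EmbeddingNorm

/-! ### Operators on `ℓ₂` -/

/-- A copy of `ℓ₂` in an arbitrary universe. -/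
theorem exists_ell2_isometry : Nonempty (Ell2 ≃ₗᵢ[ℂ] lp (fun _ : ULift.{u} ℕ => ℂ) 2) := by
  -- The basis of standard unit vectors: its coordinate isometry is the identity.
  let b : HilbertBasis ℕ ℂ Ell2 := ⟨.refl ℂ _⟩
  have hb := b.orthonormal.comp (Equiv.ulift.{u} : ULift.{u} ℕ → ℕ) Equiv.ulift.injective
  refine ⟨(HilbertBasis.mk hb ?_).repr⟩
  rw [Set.range_comp, Equiv.range_eq_univ, Set.image_univ, b.dense_span]

/-- `IsGamma2Bound` admits only Hilbert spaces in the universe of `A`, so `ℓ₂` is replaced by its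
copy over `ULift ℕ`. -/
theorem isGamma2Bound_comp {A : Type u} {B : Type v} [NormedAddCommGroup A] [NormedSpace ℂ A]
    [NormedAddCommGroup B] [NormedSpace ℂ B] (R : Ell2 →L[ℂ] B) (S : A →L[ℂ] Ell2) :
    ∃ C ≤ ‖R‖ * ‖S‖, IsGamma2Bound (R ∘L S) C := by
  obtain ⟨e⟩ := exists_ell2_isometry.{u}
  refine ⟨_, ?_, _, inferInstance, inferInstance, inferInstance,
    R ∘L (e.symm.toContinuousLinearEquiv : lp (fun _ : ULift.{u} ℕ => ℂ) 2 →L[ℂ] Ell2),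
    (e.toContinuousLinearEquiv : Ell2 →L[ℂ] lp (fun _ : ULift.{u} ℕ => ℂ) 2) ∘L S, ?_, rfl⟩
  · gcongr
    · exact ContinuousLinearMap.opNorm_le_bound _ (norm_nonneg _) fun x => by
        simpa using R.le_opNorm (e.symm x)
    · exact ContinuousLinearMap.opNorm_le_bound _ (norm_nonneg _) fun x => by
        simpa using S.le_opNorm x
  · ext x
    simp

/-- The bilinear identification of `ℓ₂` with its dual. -/
theorem exists_dual_ell2_isometry : Nonempty (StrongDual ℂ Ell2 ≃ₗᵢ[ℂ] Ell2) := by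
  -- The Riesz isometry is conjugate-linear; coordinatewise conjugation makes the composite linear.
  let s : Ell2 ≃ₗᵢ⋆[ℂ] Ell2 := starₗᵢ ℂ
  exact ⟨(InnerProductSpace.toDual ℂ Ell2).symm.trans s⟩

/-- A fixed bilinear identification of `ℓ₂` with its dual. -/
def dualEll2 : StrongDual ℂ Ell2 ≃ₗᵢ[ℂ] Ell2 := exists_dual_ell2_isometry.some

/-! ### Transposes and factorizations through `ℓ₂` -/

section Pairing

variable {A : Type u} {B : Type v} [NormedAddCommGroup A] [NormedSpace ℂ A]
  [NormedAddCommGroup B] [NormedSpace ℂ B]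

/-- The transpose of an operator on `ℓ₂`, where `ℓ₂` is identified with its dual. -/
def transposeEll2 (f : Ell2 →L[ℂ] A) : StrongDual ℂ A →L[ℂ] Ell2 :=
  (dualEll2.toContinuousLinearEquiv : StrongDual ℂ Ell2 →L[ℂ] Ell2) ∘L f.precomp ℂ

@[simp]
theorem transposeEll2_apply (f : Ell2 →L[ℂ] A) (φ : StrongDual ℂ A) :
    transposeEll2 f φ = dualEll2 (φ ∘L f) :=
  rfl

theorem norm_transposeEll2_le (f : Ell2 →L[ℂ] A) : ‖transposeEll2 f‖ ≤ ‖f‖ :=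
  ContinuousLinearMap.opNorm_le_bound _ (norm_nonneg _) fun φ => by
    rw [transposeEll2_apply, LinearIsometryEquiv.norm_map, mul_comm]
    exact φ.opNorm_comp_le f

theorem transposeEll2_add (f f' : Ell2 →L[ℂ] A) :
    transposeEll2 (f + f') = transposeEll2 f + transposeEll2 f' := by
  ext1 φ
  simp [ContinuousLinearMap.comp_add]

theorem transposeEll2_smul (c : ℂ) (f : Ell2 →L[ℂ] A) :
    transposeEll2 (c • f) = c • transposeEll2 f := by
  ext1 φ
  simp

variable (A B) in
/-- The bilinear map `(f, g) ↦ g fᵗ`. -/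
def compTranspose : (Ell2 →L[ℂ] A) →L[ℂ] (Ell2 →L[ℂ] B) →L[ℂ] (StrongDual ℂ A →L[ℂ] B) :=
  (LinearMap.mk₂ ℂ (fun f g => g ∘L transposeEll2 f)
    (fun f f' g => by rw [transposeEll2_add, ContinuousLinearMap.comp_add])
    (fun c f g => by rw [transposeEll2_smul, ContinuousLinearMap.comp_smul])
    (fun f g g' => ContinuousLinearMap.add_comp _ _ _)
    (fun c f g => ContinuousLinearMap.smul_comp _ _ _)).mkContinuous₂ 1 fun f g => by
      rw [one_mul, mul_comm]
      exact (g.opNorm_comp_le _).trans (by gcongr; exact norm_transposeEll2_le f)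

theorem Gamma2.incl_injective : Function.Injective (Gamma2.incl A B) :=
  Subtype.val_injective

theorem IsGamma2Bound.exists_gamma2 {T : A →L[ℂ] B} {C : ℝ} (h : IsGamma2Bound T C) :
    ∃ U : Gamma2 A B, Gamma2.incl A B U = T ∧ ‖U‖ ≤ C :=
  ⟨⟨T, C, h⟩, rfl, csInf_le ⟨0, fun _ hD => IsGamma2Bound.nonneg hD⟩ h⟩

theorem exists_gamma2_comp (R : Ell2 →L[ℂ] B) (S : A →L[ℂ] Ell2) :
    ∃ U : Gamma2 A B, Gamma2.incl A B U = R ∘L S ∧ ‖U‖ ≤ ‖R‖ * ‖S‖ := by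
  obtain ⟨C, hC, h⟩ := isGamma2Bound_comp R S
  obtain ⟨U, hU, hle⟩ := h.exists_gamma2
  exact ⟨U, hU, hle.trans hC⟩

/-- The bilinear map `(f, g) ↦ g fᵗ` has norm at most one as a map to `Γ₂`. -/
theorem exists_gamma2_compTranspose :
    ∃ b : (Ell2 →L[ℂ] A) →L[ℂ] (Ell2 →L[ℂ] B) →L[ℂ] Gamma2 (StrongDual ℂ A) B,
      ‖b‖ ≤ 1 ∧ ∀ f g, Gamma2.incl _ _ (b f g) = compTranspose A B f g := by
  choose U hU hle using fun (f : Ell2 →L[ℂ] A) (g : Ell2 →L[ℂ] B) =>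
    exists_gamma2_comp g (transposeEll2 f)
  have hU' : ∀ f g, Gamma2.incl _ _ (U f g) = compTranspose A B f g := hU
  -- Although `U` is chosen pointwise, it is bilinear: its composite with the injective map
  -- `Gamma2.incl` is.
  refine ⟨(LinearMap.mk₂ ℂ U ?_ ?_ ?_ ?_).mkContinuous₂ 1 ?_, ?_, hU⟩
  · intro f f' g
    apply Gamma2.incl_injective
    simp only [map_add, hU', add_apply]
  · intro c f g
    apply Gamma2.incl_injective
    simp only [map_smul, hU', smul_apply]
  · intro f g g'
    apply Gamma2.incl_injective
    simp only [map_add, hU']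
  · intro c f g
    apply Gamma2.incl_injective
    simp only [map_smul, hU']
  · intro f g
    rw [one_mul, mul_comm]
    exact (hle f g).trans (by gcongr; exact norm_transposeEll2_le f)
  · exact LinearMap.mkContinuous₂_norm_le _ zero_le_one _

/-- A finite-dimensional Hilbert space embeds isometrically into `ℓ₂`. -/
theorem exists_isometry_ell2 (K : Type*) [NormedAddCommGroup K] [InnerProductSpace ℂ K]
    [FiniteDimensional ℂ K] : Nonempty (K →ₗᵢ[ℂ] Ell2) := by
  let b : HilbertBasis ℕ ℂ Ell2 := ⟨.refl ℂ _⟩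
  let e := stdOrthonormalBasis ℂ K
  refine ⟨(e.toBasis.constr ℂ fun k => b k).isometryOfOrthonormal (v := e.toBasis) ?_ ?_⟩
  · rw [e.coe_toBasis]
    exact e.orthonormal
  · have : (e.toBasis.constr ℂ fun k => b k) ∘ e.toBasis = b ∘ Fin.val := by
      ext1 k
      exact Module.Basis.constr_basis _ _ _ _
    rw [this]
    exact b.orthonormal.comp _ Fin.val_injective

theorem finrank_strongDual (V : Type*) [NormedAddCommGroup V] [NormedSpace ℂ V]
    [FiniteDimensional ℂ V] : Module.finrank ℂ (StrongDual ℂ V) = Module.finrank ℂ V :=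
  (LinearMap.toContinuousLinearMap (𝕜 := ℂ) (E := V) (F' := ℂ)).finrank_eq.symm.trans
    Subspace.dual_finrank_eq

/-- Every operator from a dual space to `ℓ₂` is a transpose in the finite-dimensional case. -/
theorem exists_transposeEll2_eq [FiniteDimensional ℂ A] (S : StrongDual ℂ A →L[ℂ] Ell2) :
    ∃ f : Ell2 →L[ℂ] A, transposeEll2 f = S ∧ ‖f‖ ≤ ‖S‖ := by
  let J := NormedSpace.inclusionInDoubleDualLi ℂ (E := A)
  have hJ : Function.Surjective J := by
    have hdim : Module.finrank ℂ A = Module.finrank ℂ (StrongDual ℂ (StrongDual ℂ A)) := by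
      rw [finrank_strongDual, finrank_strongDual]
    exact (LinearMap.injective_iff_surjective_of_finrank_eq_finrank
      (f := J.toLinearMap) hdim).1 J.injective
  let e := LinearIsometryEquiv.ofSurjective J hJ
  -- Read as a map `A' → ℓ₂'`, `S` is a bilinear form; its flip maps `ℓ₂` to `A''`, which is `A` by
  -- the dimension count above.
  let s : StrongDual ℂ A →L[ℂ] StrongDual ℂ Ell2 :=
    (dualEll2.symm.toContinuousLinearEquiv : Ell2 →L[ℂ] StrongDual ℂ Ell2) ∘L S
  refine ⟨(e.symm.toContinuousLinearEquiv :
    StrongDual ℂ (StrongDual ℂ A) →L[ℂ] A) ∘L s.flip, ?_, ?_⟩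
  · ext1 φ
    rw [transposeEll2_apply, ← dualEll2.apply_symm_apply (S φ)]
    congr 1
    ext a
    exact DFunLike.congr_fun (e.apply_symm_apply (s.flip a)) φ
  · refine ContinuousLinearMap.opNorm_le_bound _ (norm_nonneg _) fun a => ?_
    have h1 : ‖s‖ ≤ ‖S‖ := ContinuousLinearMap.opNorm_le_bound _ (norm_nonneg _) fun φ => by
      simpa [s] using S.le_opNorm φ
    calc ‖e.symm (s.flip a)‖ = ‖s.flip a‖ := e.symm.norm_map _
      _ ≤ ‖s.flip‖ * ‖a‖ := s.flip.le_opNorm a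
      _ ≤ ‖S‖ * ‖a‖ := by rw [ContinuousLinearMap.opNorm_flip]; gcongr

/-- The dual of `A` is finite-dimensional, so the first factor has finite-dimensional range, and
this range, unlike an arbitrary Hilbert space, fits isometrically into `ℓ₂`. -/
theorem IsGamma2Bound.exists_compTranspose [FiniteDimensional ℂ A] {T : StrongDual ℂ A →L[ℂ] B}
    {C : ℝ} (h : IsGamma2Bound T C) :
    ∃ (f : Ell2 →L[ℂ] A) (g : Ell2 →L[ℂ] B), compTranspose A B f g = T ∧ ‖f‖ * ‖g‖ ≤ C := by
  obtain ⟨H, _, _, _, R, S, rfl, rfl⟩ := h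
  let K := LinearMap.range S.toLinearMap
  obtain ⟨ι⟩ := exists_isometry_ell2 K
  let S' : StrongDual ℂ A →L[ℂ] Ell2 := ι.toContinuousLinearMap ∘L S.codRestrict K fun x => ⟨x, rfl⟩
  obtain ⟨f, hf, hfS⟩ := exists_transposeEll2_eq S'
  have hι : ‖ι.toContinuousLinearMap‖ ≤ 1 := ι.norm_toContinuousLinearMap_le
  -- The adjoint of the isometry `ι` is a contraction and a left inverse of `ι`, so inserting `ι* ι`
  -- preserves the product and does not increase the norms.
  refine ⟨f, R ∘L K.subtypeL ∘L ContinuousLinearMap.adjoint ι.toContinuousLinearMap, ?_, ?_⟩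
  · change _ ∘L transposeEll2 f = _
    rw [hf]
    ext φ
    have h1 : ContinuousLinearMap.adjoint ι.toContinuousLinearMap ∘L ι.toContinuousLinearMap = 1 :=
      (ContinuousLinearMap.norm_map_iff_adjoint_comp_self _).1 ι.norm_map
    have h2 : ∀ x, ContinuousLinearMap.adjoint ι.toContinuousLinearMap (ι x) = x :=
      fun x => DFunLike.congr_fun h1 x
    simp only [S', ContinuousLinearMap.comp_apply, LinearIsometry.coe_toContinuousLinearMap, h2]
    rfl
  · rw [mul_comm]
    refine mul_le_mul ?_ (hfS.trans ?_) (norm_nonneg _) (norm_nonneg _)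
    · refine ContinuousLinearMap.opNorm_le_bound _ (norm_nonneg _) fun a => ?_
      refine R.le_opNorm_of_le ?_
      have := (ContinuousLinearMap.adjoint ι.toContinuousLinearMap).le_of_opNorm_le
        (((ContinuousLinearMap.adjoint (𝕜 := ℂ)).norm_map _).trans_le hι) a
      simpa using this
    · refine ContinuousLinearMap.opNorm_le_bound _ (norm_nonneg _) fun φ => ?_
      exact (ι.norm_map _).trans_le (S.le_opNorm φ)

end Pairing

/-! ### Finiteness of `d_θ` -/

section Couples

variable {E₀ E₁ E : Type*} [NormedAddCommGroup E₀] [NormedSpace ℂ E₀] [NormedAddCommGroup E₁]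
  [NormedSpace ℂ E₁] [NormedAddCommGroup E] [NormedSpace ℂ E]

theorem norm_smulRightL_apply_le {V : Type*} [NormedAddCommGroup V] [NormedSpace ℂ V]
    (φ : StrongDual ℂ V) : ‖ContinuousLinearMap.smulRightL ℂ V E φ‖ ≤ ‖φ‖ :=
  ContinuousLinearMap.opNorm_le_bound _ (norm_nonneg _) fun x =>
    (ContinuousLinearMap.norm_smulRight_apply φ x).le

/-- The operators `x ↦ φ ⊗ x` are bounded from `[E₀, E₁]_θ` to
`[𝓛(ℓ₂, E₀), 𝓛(ℓ₂, E₁)]_θ`, uniformly for bounded `φ`. -/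
theorem Interp.exists_smulRight (θ : Ioo (0 : ℝ) 1) (i₀ : E₀ →L[ℂ] E) (i₁ : E₁ →L[ℂ] E)
    (φ : StrongDual ℂ Ell2) (x : Interp θ i₀ i₁) :
    ∃ y : Interp θ (ContinuousLinearMap.compL ℂ Ell2 E₀ E i₀)
        (ContinuousLinearMap.compL ℂ Ell2 E₁ E i₁),
      incl θ _ _ y = incl θ i₀ i₁ ∘L φ.smulRight x ∧ ‖y‖ ≤ ‖φ‖ * (‖x‖ + 1) := by
  obtain ⟨y, hy, hle⟩ := Interp.exists_map
    (j₀ := ContinuousLinearMap.compL ℂ Ell2 E₀ E i₀)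
    (j₁ := ContinuousLinearMap.compL ℂ Ell2 E₁ E i₁)
    (ContinuousLinearMap.smulRightL ℂ Ell2 E₀ φ) (ContinuousLinearMap.smulRightL ℂ Ell2 E₁ φ)
    (ContinuousLinearMap.smulRightL ℂ Ell2 E φ) (fun e => by ext; simp) (fun e => by ext; simp)
    (K := ‖φ‖) (norm_smulRightL_apply_le φ)
    (norm_smulRightL_apply_le φ) x
  exact ⟨y, hy.trans (by ext; simp), hle⟩

/-- With a basis `b` of `[E₀, E₁]_θ` and its coordinate functionals `c`, every `T` is the sum of the
rank-one operators `(c k ∘ T) ⊗ b k`, and `Interp.exists_smulRight` handles each of them. -/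
theorem dTheta_ne_top [FiniteDimensional ℂ E₀] (θ : Ioo (0 : ℝ) 1) (i₀ : E₀ →L[ℂ] E)
    (i₁ : E₁ →L[ℂ] E) : dTheta θ i₀ i₁ ≠ ⊤ := by
  have := Interp.finiteDimensional (θ := θ) i₀ i₁
  let b := Module.finBasis ℂ (Interp θ i₀ i₁)
  let c k : StrongDual ℂ (Interp θ i₀ i₁) := LinearMap.toContinuousLinearMap (b.coord k)
  refine ne_top_of_le_ne_top ENNReal.ofReal_ne_top
    (embeddingNorm_le_ofReal (C := ∑ k, ‖c k‖ * (‖b k‖ + 1)) (by positivity) fun T => ?_)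
  choose y hy hle using fun k => Interp.exists_smulRight θ i₀ i₁ (c k ∘L T) (b k)
  refine ⟨∑ k, y k, ?_, ?_⟩
  · rw [map_sum]
    ext a
    simp only [hy, sum_apply, ContinuousLinearMap.comp_apply,
      ContinuousLinearMap.smulRight_apply, ← map_sum]
    exact congrArg _ (b.sum_repr (T a))
  · rw [Finset.sum_mul]
    refine (norm_sum_le _ _).trans (Finset.sum_le_sum fun k _ => (hle k).trans ?_)
    rw [mul_right_comm]
    gcongr
    exact (c k).opNorm_comp_le T

end Couples

end

/-! ### The embedding estimate -/

theorem lemma9 {E₀ E₁ E F₀ F₁ F : Type*}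
    [NormedAddCommGroup E₀] [NormedSpace ℂ E₀] [NormedAddCommGroup E₁] [NormedSpace ℂ E₁]
    [NormedAddCommGroup E] [NormedSpace ℂ E]
    [NormedAddCommGroup F₀] [NormedSpace ℂ F₀] [NormedAddCommGroup F₁] [NormedSpace ℂ F₁]
    [NormedAddCommGroup F] [NormedSpace ℂ F]
    (i₀ : E₀ →L[ℂ] E) (i₁ : E₁ →L[ℂ] E) (hE : IsFinDimCouple i₀ i₁)
    (j₀ : F₀ →L[ℂ] F) (j₁ : F₁ →L[ℂ] F) (hF : IsFinDimCouple j₀ j₁)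
    (θ : Set.Ioo (0 : ℝ) 1) :
    dTheta θ i₀ i₁ ≠ ⊤ ∧ dTheta θ j₀ j₁ ≠ ⊤ ∧
    embeddingNorm
        (Gamma2.ambient (Interp.incl θ i₀ i₁) (Interp.incl θ j₀ j₁))
        (Interp.incl θ (Gamma2.ambient i₀ j₀) (Gamma2.ambient i₁ j₁))
      ≤ dTheta θ i₀ i₁ * dTheta θ j₀ j₁ := by
  have := hE.finite_left
  have := hF.finite_left
  have hdE := dTheta_ne_top θ i₀ i₁
  have hdF := dTheta_ne_top θ j₀ j₁
  refine ⟨hdE, hdF, ?_⟩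
  have hfin := Interp.finiteDimensional (θ := θ) i₀ i₁
  rw [← ENNReal.ofReal_toReal hdE, ← ENNReal.ofReal_toReal hdF,
    ← ENNReal.ofReal_mul ENNReal.toReal_nonneg]
  have hnn : 0 ≤ (dTheta θ i₀ i₁).toReal * (dTheta θ j₀ j₁).toReal := by positivity
  refine embeddingNorm_le_ofReal hnn fun T => ?_
  -- The infimum defining `γ₂(T)` need not be attained a priori, so the estimate is first proved
  -- with any `c > ‖T‖` in its place.
  have key : ∀ c, ‖T‖ < c → ∃ w : Interp θ (Gamma2.ambient i₀ j₀) (Gamma2.ambient i₁ j₁),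
      Interp.incl θ _ _ w = Gamma2.ambient (Interp.incl θ i₀ i₁) (Interp.incl θ j₀ j₁) T ∧
        ‖w‖ ≤ (dTheta θ i₀ i₁).toReal * (dTheta θ j₀ j₁).toReal * c := by
    intro c hc
    obtain ⟨C, hC, hlt⟩ := exists_lt_of_csInf_lt
      (s := {C : ℝ | IsGamma2Bound (Gamma2.inclₗ _ _ T) C}) T.2 hc
    obtain ⟨f, g, hfg, hle⟩ := IsGamma2Bound.exists_compTranspose hC
    obtain ⟨x, hx, hxle⟩ := exists_norm_le_embeddingNorm (Interp.incl_injective _ _) hdE f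
    obtain ⟨y, hy, hyle⟩ := exists_norm_le_embeddingNorm (Interp.incl_injective _ _) hdF g
    obtain ⟨b₀, hb₀, hb₀'⟩ := exists_gamma2_compTranspose (A := E₀) (B := F₀)
    obtain ⟨b₁, hb₁, hb₁'⟩ := exists_gamma2_compTranspose (A := E₁) (B := F₁)
    obtain ⟨w, hw, hwle⟩ := Interp.exists_bilin (Z := StrongDual ℂ E →L[ℂ] F)
      (i₀ := ContinuousLinearMap.compL ℂ Ell2 E₀ E i₀)
      (i₁ := ContinuousLinearMap.compL ℂ Ell2 E₁ E i₁)
      (j₀ := ContinuousLinearMap.compL ℂ Ell2 F₀ F j₀)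
      (j₁ := ContinuousLinearMap.compL ℂ Ell2 F₁ F j₁)
      (k₀ := Gamma2.ambient i₀ j₀) (k₁ := Gamma2.ambient i₁ j₁) b₀ b₁ (compTranspose E F)
      -- Naturality of the transpose: `(j₀ v) (i₀ u)ᵗ` is `v uᵗ` preceded by restriction of
      -- functionals and followed by `j₀`.
      (fun u v => by
        ext φ
        exact congrArg j₀ (DFunLike.congr_fun (hb₀' u v) (dualRestrict i₀ φ)))
      (fun u v => by
        ext φ
        exact congrArg j₁ (DFunLike.congr_fun (hb₁' u v) (dualRestrict i₁ φ))) hb₀ hb₁ x y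
    refine ⟨w, ?_, hwle.trans ?_⟩
    · rw [hw, hx, hy]
      ext φ
      exact congrArg (Interp.incl θ j₀ j₁)
        (DFunLike.congr_fun hfg (dualRestrict (Interp.incl θ i₀ i₁) φ))
    · calc ‖x‖ * ‖y‖ ≤ ((dTheta θ i₀ i₁).toReal * ‖f‖) * ((dTheta θ j₀ j₁).toReal * ‖g‖) :=
          mul_le_mul hxle hyle (norm_nonneg _) (by positivity)
        _ = (dTheta θ i₀ i₁).toReal * (dTheta θ j₀ j₁).toReal * (‖f‖ * ‖g‖) := by ring
        _ ≤ _ := mul_le_mul_of_nonneg_left (hle.trans hlt.le) hnn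
  -- By injectivity of the inclusion, `w` does not depend on `c`, so `c` may decrease to `‖T‖`.
  obtain ⟨w, hw, -⟩ := key _ (lt_add_one _)
  refine ⟨w, hw, ?_⟩
  have hlim : Filter.Tendsto
      (fun c => (dTheta θ i₀ i₁).toReal * (dTheta θ j₀ j₁).toReal * c) (nhdsWithin ‖T‖ (Ioi ‖T‖))
      (nhds ((dTheta θ i₀ i₁).toReal * (dTheta θ j₀ j₁).toReal * ‖T‖)) :=
    tendsto_nhdsWithin_of_tendsto_nhds (Continuous.tendsto (by fun_prop) _)
  refine ge_of_tendsto hlim (eventually_mem_nhdsWithin.mono fun c hc => ?_)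
  obtain ⟨w', hw', hle⟩ := key c hc
  rwa [Interp.incl_injective _ _ (hw.trans hw'.symm)]
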